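/- **Definitions.** For $E,F\subseteq X\times X$ put $E\circ F=\{(x,z):\exists y\;(x,y)\in E,\ (y,z)\in F\}$, $F^{-1}=\{(y,x):(x,y)\in F\}$, $E[x]=\{y:(x,y)\in E\}$ and $E[A]=\bigcup_{a\in A}E[a]$. A *ballean* is a set $X$ with a family $\mathcal E_X$ of subsets of $X\times X$ (*entourages*) such that every $E\in\mathcal E_X$ contains the diagonal, for all $E,F\in\mathcal E_X$ there is $D\in\mathcal E_X$ with $E\circ F^{-1}\subseteq D$, and $\bigcup\mathcal E_X=X\times X$. The subballean on $Y\subseteq X$ has the entourages $E\cap(Y\times Y)$, $E\in\mathcal E_X$. A set $B\subseteq X$ is *bounded* if $B\subseteq E[x]$ for some $E\in\mathcal E_X$, $x\in X$; the *bornology* $\mathcal B_X$ is the family of all bounded sets. It *has a linearly ordered base* if some $\mathcal C\subseteq\mathcal B_X$ is linearly ordered by inclusion and every $B\in\mathcal B_X$ is contained in some $C\in\mathcal C$. The cofinality $\mathrm{cof}(P)$ of a partially ordered set $P$ is the smallest cardinality of a cofinal subset of $P$; $X$ is *cof-regular* if $\mathrm{cof}(\mathcal E_X)=\mathrm{cof}(\mathcal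 B_X)$, both families being ordered by inclusion. Sets $A,B\subseteq X$ are *asymptotically disjoint* if $E[A]\cap E[B]$ is bounded for every $E\in\mathcal E_X$. A set $U\subseteq X$ is an *asymptotic neighborhood* of $A$ if $E[A]\setminus U$ is bounded for every $E\in\mathcal E_X$. A ballean is *normal* if any two asymptotically disjoint sets have disjoint asymptotic neighborhoods, and *ultranormal* if it contains no two asymptotically disjoint unbounded sets. The power $X^n$ has the entourages $\{(x,y):\forall i<n\ (x_i,y_i)\in E_i\}$ with $E_0,\dots,E_{n-1}\in\mathcal E_X$. For a subgroup $G\le S_n$, the *$G$-symmetric power* $[X]^n_G$ is the set of classes $xG=\{x\circ g:g\in G\}$, $x\in X^n$, with the entourages $\{(xG,yG):(x,y)\in E\}$, $E\in\mathcal E_{X^n}$; the *symmetric square* is $[X]^2=[X]^2_{S_2}$. The *hyperballean* $[X]^{\mathcal B}$ is the set of non-empty bounded subsets of $X$ with the entourages $\{(A,B):A\subseteq E[B],\ B\subseteq E[A]\}$, $E\in\mathcal E_X$; the *hypersymmetric power* $[X]^{\le n}$ is its subballean $\{A\in[X]^{\mathcal B}:|A|\le n\}$. **Theorem 1.12.**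 For a cof-regular ballean $X$ the following conditions are equivalent: 1. for every $n\ge1$ and every subgroup $G\le S_n$ the ballean $[X]^n_G$ is normal; 2. for some $n\ge3$ and some subgroup $G\le S_n$ the ballean $[X]^n_G$ is normal; 3. for every $n\ge1$ the ballean $X^n$ is normal; 4. for some $n\ge2$ the ballean $X^n$ is normal; 5. the bornology $\mathcal B_X$ of $X$ has a linearly ordered base. If the ballean $X$ is not ultranormal, then the conditions (1)–(5) are equivalent to each of: 6. for some $n\ge2$ and some subgroup $G\le S_n$ the ballean $[X]^n_G$ is normal; 7. the symmetric square $[X]^2$ of $X$ is normal; 8. the hypersymmetric square $[X]^{\le2}$ of $X$ is normal; 9. for some $n\ge2$ the ballean $[X]^{\le n}$ is normal; 10. for every $n\ge1$ the ballean $[X]^{\le n}$ is normal; 11. the hyperballean $[X]^{\mathcal B}$ of $X$ is normal. -/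

import Mathlib

open Set

open scoped SetRel

universe u v

/-- A ballean with underlying set `α`: a ball structure on `α`, that is, a family of
entourages `E ⊆ α × α` satisfying the three axioms below. -/
structure Ballean (α : Type u) where
  /-- The ball structure. -/
  entourages : Set (SetRel α α)
  /-- Every entourage contains the diagonal. -/
  refl_mem : ∀ E ∈ entourages, ∀ x, (x, x) ∈ E
  /-- For any entourages `E`, `F` some entourage contains `E ∘ F⁻¹`. -/
  comp_inv : ∀ E ∈ entourages, ∀ F ∈ entourages, ∃ D ∈ entourages, E ○ F.inv ⊆ D
  /-- The entourages cover `α × α`. -/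
  cover : ⋃₀ entourages = (Set.univ : Set (α × α))

namespace Ballean

variable {α : Type u}

/-! ### Basic facts on entourages, used to construct new balleans -/

theorem exists_entourage (X : Ballean α) (x y : α) : ∃ E ∈ X.entourages, (x, y) ∈ E := by
  have h : (x, y) ∈ ⋃₀ X.entourages := by rw [X.cover]; trivial
  simpa using h

theorem exists_inv (X : Ballean α) {E F : SetRel α α} (hE : E ∈ X.entourages)
    (hF : F ∈ X.entourages) :
    ∃ D ∈ X.entourages, E ⊆ D ∧ ∀ x y, (x, y) ∈ F → (y, x) ∈ D := by
  obtain ⟨D, hD, h⟩ := X.comp_inv E hE F hF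
  refine ⟨D, hD, ?_, ?_⟩
  · rintro ⟨x, y⟩ hxy
    exact h ⟨y, hxy, X.refl_mem F hF y⟩
  · intro x y hxy
    exact h ⟨y, X.refl_mem E hE y, hxy⟩

theorem exists_sup (X : Ballean α) {E F : SetRel α α} (hE : E ∈ X.entourages)
    (hF : F ∈ X.entourages) : ∃ D ∈ X.entourages, E ⊆ D ∧ F ⊆ D := by
  obtain ⟨D, hD, hED, hFD⟩ := X.exists_inv hE hF
  obtain ⟨D', hD', h, h'⟩ := X.exists_inv hD hD
  exact ⟨D', hD', hED.trans h, fun p hp => h' _ _ (hFD p.1 p.2 hp)⟩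

/-- Finitely many entourages have a common upper bound. -/
theorem exists_bound (X : Ballean α) {E₀ : SetRel α α} (h₀ : E₀ ∈ X.entourages) :
    ∀ (n : ℕ) (E : Fin n → SetRel α α), (∀ i, E i ∈ X.entourages) →
      ∃ D ∈ X.entourages, ∀ i, E i ⊆ D := by
  intro n
  induction n with
  | zero => exact fun _ _ => ⟨E₀, h₀, fun i => i.elim0⟩
  | succ n ih =>
    intro E hE
    obtain ⟨D, hD, h⟩ := ih (fun i => E i.succ) (fun i => hE _)
    obtain ⟨D', hD', h1, h2⟩ := X.exists_sup hD (hE 0)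
    exact ⟨D', hD', fun i => Fin.cases h2 (fun j => (h j).trans h1) i⟩

/-! ### Bounded sets and normality -/

/-- A set is bounded if it is contained in a ball `E[x]`. -/
def IsBounded (X : Ballean α) (B : Set α) : Prop :=
  ∃ E ∈ X.entourages, ∃ x : α, B ⊆ {y | (x, y) ∈ E}

/-- The bornology of a ballean: the family of its bounded sets. -/
def bornology (X : Ballean α) : Set (Set α) := {B | X.IsBounded B}

/-- `A`, `B` are asymptotically disjoint if `E[A] ∩ E[B]` is bounded for every entourage `E`;
here `SetRel.image E A` is the `E`-neighborhood `E[A] = ⋃_{a ∈ A} E[a]`. -/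
def AsympDisjoint (X : Ballean α) (A B : Set α) : Prop :=
  ∀ E ∈ X.entourages, X.IsBounded (SetRel.image E A ∩ SetRel.image E B)

/-- `U` is an asymptotic neighborhood of `A` if `E[A] \ U` is bounded for every entourage `E`. -/
def IsAsympNhd (X : Ballean α) (U A : Set α) : Prop :=
  ∀ E ∈ X.entourages, X.IsBounded (SetRel.image E A \ U)

/-- A ballean is normal if any two asymptotically disjoint sets have disjoint asymptotic
neighborhoods. -/
def IsNormal (X : Ballean α) : Prop :=
  ∀ A B : Set α, X.AsympDisjoint A B →
    ∃ U V : Set α, X.IsAsympNhd U A ∧ X.IsAsympNhd V B ∧ Disjoint U V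

/-- A ballean is ultranormal if it contains no two asymptotically disjoint unbounded sets. -/
def IsUltranormal (X : Ballean α) : Prop :=
  ¬ ∃ A B : Set α, ¬ X.IsBounded A ∧ ¬ X.IsBounded B ∧ X.AsympDisjoint A B

/-- A ballean is cof-regular if its ball structure and its bornology, both ordered by
inclusion, have the same cofinality. -/
def IsCofRegular (X : Ballean α) : Prop :=
  Order.cof X.entourages = Order.cof X.bornology

/-- The bornology has a linearly ordered base: a cofinal subfamily that is a chain
under inclusion. -/
def HasLinearBornologyBase (X : Ballean α) : Prop :=
  ∃ C : Set (Set α), C ⊆ X.bornology ∧ IsChain (· ⊆ ·) C ∧ ∀ B ∈ X.bornology, ∃ D ∈ C, B ⊆ D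

/-! ### Constructions -/

/-- The subballean on a subset `Y`. -/
def restrict (X : Ballean α) (Y : Set α) : Ballean Y where
  entourages := {F | ∃ E ∈ X.entourages, F = {p : Y × Y | ((p.1 : α), (p.2 : α)) ∈ E}}
  refl_mem := by
    rintro _ ⟨E, hE, rfl⟩ x
    exact X.refl_mem E hE x
  comp_inv := by
    rintro _ ⟨E, hE, rfl⟩ _ ⟨F, hF, rfl⟩
    obtain ⟨D, hD, h⟩ := X.comp_inv E hE F hF
    refine ⟨_, ⟨D, hD, rfl⟩, ?_⟩
    rintro ⟨x, z⟩ ⟨y, hxy, hyz⟩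
    exact h ⟨y, hxy, hyz⟩
  cover := by
    refine eq_univ_of_forall ?_
    rintro ⟨x, y⟩
    obtain ⟨E, hE, h⟩ := X.exists_entourage (x : α) (y : α)
    exact ⟨_, ⟨E, hE, rfl⟩, h⟩

/-- The product entourage of a family of relations. -/
def prodRel {ι : Type v} {β : ι → Type u} (E : ∀ i, SetRel (β i) (β i)) :
    SetRel (∀ i, β i) (∀ i, β i) :=
  {p | ∀ i, (p.1 i, p.2 i) ∈ E i}

/-- The (box-)product of a family of balleans. -/
def pi {ι : Type v} {β : ι → Type u} (X : ∀ i, Ballean (β i)) : Ballean (∀ i, β i) where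
  entourages := {P | ∃ E : ∀ i, SetRel (β i) (β i), (∀ i, E i ∈ (X i).entourages) ∧ P = prodRel E}
  refl_mem := by
    rintro _ ⟨E, hE, rfl⟩ x i
    exact (X i).refl_mem (E i) (hE i) (x i)
  comp_inv := by
    rintro _ ⟨E, hE, rfl⟩ _ ⟨F, hF, rfl⟩
    choose D hD h using fun i => (X i).comp_inv (E i) (hE i) (F i) (hF i)
    refine ⟨_, ⟨D, hD, rfl⟩, ?_⟩
    rintro ⟨x, z⟩ ⟨y, hxy, hyz⟩ i
    exact h i ⟨y i, hxy i, hyz i⟩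
  cover := by
    refine eq_univ_of_forall ?_
    rintro ⟨x, y⟩
    choose E hE h using fun i => (X i).exists_entourage (x i) (y i)
    exact ⟨_, ⟨E, hE, rfl⟩, h⟩

/-- The power `X^n`. -/
def power (X : Ballean α) (n : ℕ) : Ballean (Fin n → α) := pi fun _ : Fin n => X

/-- The equivalence relation on `αⁿ` induced by a group `G ≤ Sₙ` permuting the coordinates:
`x ∼ y` iff `y = x ∘ g` for some `g ∈ G`. -/
def permSetoid (α : Type u) {n : ℕ} (G : Subgroup (Equiv.Perm (Fin n))) :
    Setoid (Fin n → α) where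
  r x y := ∃ g ∈ G, y = x ∘ g
  iseqv :=
    { refl := fun x => ⟨1, G.one_mem, rfl⟩
      symm := by
        rintro x _ ⟨g, hg, rfl⟩
        exact ⟨g⁻¹, G.inv_mem hg, by ext i; simp⟩
      trans := by
        rintro x _ _ ⟨g, hg, rfl⟩ ⟨h, hh, rfl⟩
        exact ⟨g * h, G.mul_mem hg hh, by ext i; simp⟩ }

/-- The class `xG` of `x`. -/
def permClass {n : ℕ} (G : Subgroup (Equiv.Perm (Fin n))) (x : Fin n → α) :
    Quotient (permSetoid α G) :=
  Quotient.mk (permSetoid α G) x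

theorem permClass_eq {n : ℕ} {G : Subgroup (Equiv.Perm (Fin n))} {x y : Fin n → α}
    (h : permClass G x = permClass G y) : ∃ g ∈ G, y = x ∘ g :=
  Quotient.exact h

theorem permClass_comp {n : ℕ} {G : Subgroup (Equiv.Perm (Fin n))} (x : Fin n → α)
    {g : Equiv.Perm (Fin n)} (hg : g ∈ G) : permClass G (x ∘ g) = permClass G x :=
  (Quotient.sound (s := permSetoid α G) ⟨g, hg, rfl⟩).symm

/-- The `G`-symmetric power `[X]ⁿ_G`, with the entourages `{(xG, yG) : (x, y) ∈ E}` for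
`E` an entourage of `Xⁿ`. -/
def symPower (X : Ballean α) {n : ℕ} (G : Subgroup (Equiv.Perm (Fin n))) :
    Ballean (Quotient (permSetoid α G)) where
  entourages := {P | ∃ E ∈ (X.power n).entourages,
    P = {q | ∃ x y : Fin n → α, (x, y) ∈ E ∧ q = (permClass G x, permClass G y)}}
  refl_mem := by
    rintro _ ⟨E, hE, rfl⟩ q
    induction q using Quotient.inductionOn with
    | h x => exact ⟨x, x, (X.power n).refl_mem E hE x, rfl⟩
  comp_inv := by
    rintro _ ⟨E, hE, rfl⟩ _ ⟨F, hF, rfl⟩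
    obtain ⟨E, hE', rfl⟩ := hE
    obtain ⟨F, hF', rfl⟩ := hF
    rcases n with _ | n
    · refine ⟨_, ⟨_, ⟨E, hE', rfl⟩, rfl⟩, ?_⟩
      rintro ⟨p, r⟩ -
      induction p using Quotient.inductionOn with
      | h x =>
        induction r using Quotient.inductionOn with
        | h y => exact ⟨x, y, fun i => i.elim0, rfl⟩
    · obtain ⟨E₁, hE₁, h₁⟩ := X.exists_bound (hE' 0) _ E hE'
      obtain ⟨F₁, hF₁, h₂⟩ := X.exists_bound (hF' 0) _ F hF'
      obtain ⟨D, hD, h⟩ := X.comp_inv E₁ hE₁ F₁ hF₁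
      refine ⟨_, ⟨_, ⟨fun _ => D, fun _ => hD, rfl⟩, rfl⟩, ?_⟩
      rintro ⟨p, r⟩ ⟨q, ⟨x, y, hxy, he⟩, ⟨z, y', hzy, he'⟩⟩
      obtain ⟨rfl, rfl⟩ := Prod.mk.inj he
      obtain ⟨rfl, he''⟩ := Prod.mk.inj he'
      obtain ⟨g, hg, rfl⟩ := permClass_eq he''
      refine ⟨x ∘ g, z, fun i => h ⟨y (g i), h₁ _ (hxy (g i)), h₂ _ (hzy i)⟩, ?_⟩
      rw [permClass_comp x hg]
  cover := by
    refine eq_univ_of_forall ?_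
    rintro ⟨p, r⟩
    induction p using Quotient.inductionOn with
    | h x =>
      induction r using Quotient.inductionOn with
      | h y =>
        obtain ⟨E, hE, h⟩ := (X.power n).exists_entourage x y
        exact ⟨_, ⟨E, hE, rfl⟩, x, y, h, rfl⟩

/-- The set of non-empty bounded subsets of a ballean. -/
abbrev Hyper (X : Ballean α) : Type u := {A : Set α // A.Nonempty ∧ X.IsBounded A}

/-- The hyperballean: the non-empty bounded sets of `X`, with the entourages
`{(A, B) : A ⊆ E[B], B ⊆ E[A]}` for `E` an entourage of `X`. -/
def hyperballean (X : Ballean α) : Ballean X.Hyper where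
  entourages := {P | ∃ E ∈ X.entourages,
    P = {p : X.Hyper × X.Hyper |
      p.1.1 ⊆ SetRel.image E p.2.1 ∧ p.2.1 ⊆ SetRel.image E p.1.1}}
  refl_mem := by
    rintro _ ⟨E, hE, rfl⟩ A
    exact ⟨fun a ha => ⟨a, ha, X.refl_mem E hE a⟩, fun a ha => ⟨a, ha, X.refl_mem E hE a⟩⟩
  comp_inv := by
    rintro _ ⟨E, hE, rfl⟩ _ ⟨F, hF, rfl⟩
    obtain ⟨D₁, hD₁, hED, hFD⟩ := X.exists_sup hE hF
    obtain ⟨D₂, hD₂, h₁₂, hinv⟩ := X.exists_inv hD₁ hD₁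
    obtain ⟨D, hD, h⟩ := X.comp_inv D₂ hD₂ D₂ hD₂
    refine ⟨_, ⟨D, hD, rfl⟩, ?_⟩
    have key : ∀ x y z, (x, y) ∈ D₁ → (y, z) ∈ D₁ → (x, z) ∈ D := fun x y z hxy hyz =>
      h ⟨y, h₁₂ hxy, hinv _ _ hyz⟩
    rintro ⟨A, C⟩ ⟨B, ⟨hAB, hBA⟩, ⟨hCB, hBC⟩⟩
    refine ⟨fun a ha => ?_, fun c hc => ?_⟩
    · obtain ⟨b, hb, hba⟩ := hAB ha
      obtain ⟨c, hc, hcb⟩ := hBC hb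
      exact ⟨c, hc, key _ _ _ (hFD hcb) (hED hba)⟩
    · obtain ⟨b, hb, hbc⟩ := hCB hc
      obtain ⟨a, ha, hab⟩ := hBA hb
      exact ⟨a, ha, key _ _ _ (hED hab) (hFD hbc)⟩
  cover := by
    refine eq_univ_of_forall ?_
    rintro ⟨⟨A, ⟨a₀, ha₀⟩, E, hE, x, hA⟩, ⟨B, ⟨b₀, hb₀⟩, F, hF, y, hB⟩⟩
    obtain ⟨K, hK, hxy⟩ := X.exists_entourage x y
    obtain ⟨D₁, hD₁, hED, hFD⟩ := X.exists_sup hE hF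
    obtain ⟨D₂, hD₂, h₁₂, hKD⟩ := X.exists_sup hD₁ hK
    obtain ⟨S, hS, h₂S, hinv⟩ := X.exists_inv hD₂ hD₂
    have comp : ∀ {P Q : SetRel α α}, P ∈ X.entourages → Q ∈ X.entourages →
        ∃ D ∈ X.entourages, ∀ x y z, (x, y) ∈ P → (y, z) ∈ Q → (x, z) ∈ D := by
      intro P Q hP hQ
      obtain ⟨Q', hQ', -, hq⟩ := X.exists_inv hQ hQ
      obtain ⟨D, hD, h⟩ := X.comp_inv P hP Q' hQ'
      exact ⟨D, hD, fun x y z hxy hyz => h ⟨y, hxy, hq _ _ hyz⟩⟩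
    obtain ⟨S₂, hS₂, h2⟩ := comp hS hS
    obtain ⟨S₃, hS₃, h3⟩ := comp hS₂ hS
    refine ⟨_, ⟨S₃, hS₃, rfl⟩, fun a ha => ⟨b₀, hb₀, ?_⟩, fun b hb => ⟨a₀, ha₀, ?_⟩⟩
    · exact h3 _ x _ (h2 _ y _ (hinv _ _ (h₁₂ (hFD (hB hb₀)))) (hinv _ _ (hKD hxy)))
        (h₂S (h₁₂ (hED (hA ha))))
    · exact h3 _ y _ (h2 _ x _ (hinv _ _ (h₁₂ (hED (hA ha₀)))) (h₂S (hKD hxy)))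
        (h₂S (h₁₂ (hFD (hB hb))))

/-- The hypersymmetric power `[X]^{≤n}`: the subballean of the hyperballean consisting of the
sets with at most `n` elements. -/
def hyperSymPower (X : Ballean α) (n : ℕ) :
    Ballean {A : X.Hyper | (A : Set α).encard ≤ n} :=
  X.hyperballean.restrict {A : X.Hyper | (A : Set α).encard ≤ n}

end Ballean

namespace Ballean

variable {α : Type u} {β : Type v}

/-! ### Entourages and bounded sets -/

/-! Powers, symmetric powers and hyperballeans are treated uniformly: each point carries a bounded
support in `X`, and boundedness and entourages are controlled by supports (`IsHyperLike`).

From a linear base to normality: cof-regularity gives a base of entourages `E i`, indexed so that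
unions of bounded sets over initial segments stay bounded. Removing from `E i [A]` all `E j [B]`
with `j ≤ i`, and taking the union over `i`, gives an asymptotic neighborhood of `A`; it is disjoint
from the one obtained by swapping `A` and `B` (`IsHyperLike.isNormal`).

From normality to a linear base: let pairs `m x y` live in `Y`, and separate the axes `m p x₀`, `p ∈
P`, and `m x₀ s`, `s ∈ S`. A pair `m p s` cannot lie in both neighborhoods, which gives the relation
`Interlaced`. This bounds the cofinality of the bornology traced on `P` by its additivity on `S`,
and conversely; equality of the two yields a chain.

In powers, and in symmetric powers with `n ≥ 3`, the full axes are asymptotically disjoint, so `P =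
S = univ` works. In the remaining cases the axes may coincide; failure of ultranormality supplies
asymptotically disjoint unbounded `P`, `Q`, from which the whole of `X` is reached by a chain of
interlaced sets. -/

theorem entourages_nonempty (X : Ballean α) [Nonempty α] : X.entourages.Nonempty := by
  obtain ⟨x⟩ := ‹Nonempty α›
  obtain ⟨E, hE, -⟩ := X.exists_entourage x x
  exact ⟨E, hE⟩

theorem exists_comp (X : Ballean α) {E F : SetRel α α} (hE : E ∈ X.entourages)
    (hF : F ∈ X.entourages) :
    ∃ D ∈ X.entourages, ∀ x y z, (x, y) ∈ E → (y, z) ∈ F → (x, z) ∈ D := by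
  obtain ⟨F', hF', -, h⟩ := X.exists_inv hF hF
  obtain ⟨D, hD, h'⟩ := X.comp_inv E hE F' hF'
  exact ⟨D, hD, fun x y z hxy hyz => h' ⟨y, hxy, h _ _ hyz⟩⟩

theorem IsBounded.mono {X : Ballean α} {A B : Set α} (hB : X.IsBounded B) (h : A ⊆ B) :
    X.IsBounded A := by
  obtain ⟨E, hE, x, hx⟩ := hB
  exact ⟨E, hE, x, h.trans hx⟩

theorem IsBounded.exists_center {X : Ballean α} {B : Set α} (hB : X.IsBounded B) (x : α) :
    ∃ E ∈ X.entourages, ∀ y ∈ B, (x, y) ∈ E := by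
  obtain ⟨E, hE, z, hz⟩ := hB
  obtain ⟨F, hF, hxz⟩ := X.exists_entourage x z
  obtain ⟨D, hD, h⟩ := X.exists_comp hF hE
  exact ⟨D, hD, fun y hy => h _ _ _ hxz (hz hy)⟩

theorem isBounded_singleton (X : Ballean α) (x : α) : X.IsBounded {x} := by
  obtain ⟨E, hE, h⟩ := X.exists_entourage x x
  exact ⟨E, hE, x, by simpa using h⟩

theorem isBounded_empty (X : Ballean α) [Nonempty α] : X.IsBounded ∅ :=
  (X.isBounded_singleton (Classical.arbitrary α)).mono (empty_subset _)

theorem IsBounded.union {X : Ballean α} {A B : Set α} (hA : X.IsBounded A)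
    (hB : X.IsBounded B) : X.IsBounded (A ∪ B) := by
  obtain ⟨E, hE, x, hx⟩ := hA
  obtain ⟨F, hF, hy⟩ := hB.exists_center x
  obtain ⟨D, hD, h₁, h₂⟩ := X.exists_sup hE hF
  refine ⟨D, hD, x, union_subset (fun y h => h₁ (hx h)) (fun y h => h₂ (hy y h))⟩

theorem isBounded_biUnion {ι : Type*} {X : Ballean α} [Nonempty α] {s : Set ι}
    (hs : s.Finite) {B : ι → Set α} (hB : ∀ i ∈ s, X.IsBounded (B i)) :
    X.IsBounded (⋃ i ∈ s, B i) := by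
  induction s, hs using Set.Finite.induction_on with
  | empty => simpa using X.isBounded_empty
  | insert _ _ ih =>
    rw [biUnion_insert]
    exact (hB _ (mem_insert _ _)).union (ih fun i hi => hB i (mem_insert_of_mem _ hi))

theorem IsBounded.image {X : Ballean α} {B : Set α} (hB : X.IsBounded B) {E : SetRel α α}
    (hE : E ∈ X.entourages) : X.IsBounded (SetRel.image E B) := by
  obtain ⟨F, hF, x, hx⟩ := hB
  obtain ⟨D, hD, h⟩ := X.exists_comp hF hE
  refine ⟨D, hD, x, ?_⟩
  rintro z ⟨y, hy, hyz⟩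
  exact h _ _ _ (hx hy) hyz

theorem isNormal_of_isEmpty [IsEmpty α] (X : Ballean α) : X.IsNormal := by
  intro A B h
  refine ⟨∅, ∅, fun E hE => ?_, fun E hE => ?_, disjoint_bot_left⟩ <;>
  · obtain ⟨-, -, x, -⟩ := h E hE
    exact isEmptyElim x

theorem AsympDisjoint.symm {X : Ballean α} {A B : Set α} (h : X.AsympDisjoint A B) :
    X.AsympDisjoint B A := fun E hE => by
  rw [inter_comm]; exact h E hE

/-- The complement of an asymptotic neighborhood of `A` is asymptotically disjoint from `A`. -/
theorem IsAsympNhd.asympDisjoint_compl {X : Ballean α} {U A : Set α} (h : X.IsAsympNhd U A) :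
    X.AsympDisjoint A Uᶜ := by
  intro E hE
  obtain ⟨E', hE', -, hinv⟩ := X.exists_inv hE hE
  obtain ⟨D, hD, hc⟩ := X.exists_comp hE hE'
  -- With `D` absorbing `E` followed by its inverse, a point `z ∉ U` whose `E`-ball meets `E[A]`
  -- lies in `D[A] \ U`.
  refine ((h D hD).image hE).mono ?_
  rintro y ⟨⟨a, ha, hay⟩, ⟨z, hz, hzy⟩⟩
  exact ⟨z, ⟨⟨a, ha, hc _ _ _ hay (hinv _ _ hzy)⟩, hz⟩, hzy⟩

theorem IsAsympNhd.isBounded_diff {X : Ballean α} [Nonempty α] {U A : Set α}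
    (h : X.IsAsympNhd U A) : X.IsBounded (A \ U) := by
  obtain ⟨E, hE⟩ := X.entourages_nonempty
  exact (h E hE).mono fun a ha => ⟨⟨a, ha.1, X.refl_mem E hE a⟩, ha.2⟩

/-! ### Families of bounded sets and linearly ordered bases -/

/-- Every type has a linear order in which each initial segment is finite or of smaller
cardinality than the whole type. -/
theorem exists_linearOrder_finite_or_mk_Iic_lt (ι : Type u) :
    ∃ _ : LinearOrder ι, ∀ i : ι, (Iic i).Finite ∨ Cardinal.mk (Iic i) < Cardinal.mk ι := by
  obtain ⟨L, hwf, h⟩ := Cardinal.exists_ord_eq_type_lt ι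
  refine ⟨L, fun i => ?_⟩
  have hlt : Cardinal.mk (Iio i) < Cardinal.mk ι := Cardinal.mk_Iio_lt i h
  rcases finite_or_infinite ι with hι | hι
  -- Finite types need their own alternative: adding the endpoint to `Iio i` can restore full
  -- cardinality.
  · exact Or.inl (toFinite _)
  · right
    have : Iic i = insert i (Iio i) := by
      ext j; simp [le_iff_eq_or_lt]
    rw [this]
    refine (Cardinal.mk_insert_le).trans_lt ?_
    exact Cardinal.add_lt_of_lt (Cardinal.aleph0_le_mk ι) hlt
      (Cardinal.one_lt_aleph0.trans_le (Cardinal.aleph0_le_mk ι))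

/-- Unions of fewer than `c` bounded sets are bounded on `S`. -/
def IsAdditiveOn (X : Ballean α) (c : Cardinal.{u}) (S : Set α) : Prop :=
  ∀ 𝒟 ⊆ X.bornology, Cardinal.mk 𝒟 < c → X.IsBounded (S ∩ ⋃₀ 𝒟)

/-- The family `𝒟` of bounded sets is cofinal in the bornology as seen from `S`. -/
def Dominates (X : Ballean α) (𝒟 : Set (Set α)) (S : Set α) : Prop :=
  𝒟 ⊆ X.bornology ∧ ∀ B ∈ X.bornology, ∃ D ∈ 𝒟, S ∩ B ⊆ D

theorem IsAdditiveOn.exists_linearOrder {X : Ballean α} [Nonempty α] {ι : Type u}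
    (h : X.IsAdditiveOn (Cardinal.mk ι) univ) :
    ∃ _ : LinearOrder ι, ∀ (i : ι) (B : ι → Set α), (∀ j, X.IsBounded (B j)) →
      X.IsBounded (⋃ j ∈ Iic i, B j) := by
  obtain ⟨L, hL⟩ := exists_linearOrder_finite_or_mk_Iic_lt ι
  refine ⟨L, fun i B hB => ?_⟩
  rcases hL i with hi | hi
  · exact isBounded_biUnion hi fun j _ => hB j
  · have := h (B '' Iic i) (by rintro _ ⟨j, -, rfl⟩; exact hB j)
      (Cardinal.mk_image_le.trans_lt hi)
    simpa [sUnion_image] using this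

/-- Accumulating both families along initial segments turns them into a chain. Since they share the
index type, the larger of two indices serves on `S` and `T` at once. -/
theorem hasLinearBornologyBase_of_index {X : Ballean α} [Nonempty α] {ι : Type u}
    (h : X.IsAdditiveOn (Cardinal.mk ι) univ) {S T : Set α} (hST : S ∪ T = univ)
    {D D' : ι → Set α} (hD : ∀ i, X.IsBounded (D i)) (hD' : ∀ i, X.IsBounded (D' i))
    (hS : ∀ B, X.IsBounded B → ∃ i, S ∩ B ⊆ D i) (hT : ∀ B, X.IsBounded B → ∃ i, T ∩ B ⊆ D' i) :
    X.HasLinearBornologyBase := by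
  obtain ⟨L, hL⟩ := h.exists_linearOrder
  let C : ι → Set α := fun i => ⋃ j ∈ Iic i, (D j ∪ D' j)
  have hC : Monotone C := fun i j hij => biUnion_subset_biUnion_left (Iic_subset_Iic.2 hij)
  refine ⟨range C, ?_, ?_, fun B hB => ?_⟩
  · rintro _ ⟨i, rfl⟩
    exact hL i _ fun j => (hD j).union (hD' j)
  · rintro _ ⟨i, rfl⟩ _ ⟨j, rfl⟩ -
    exact (le_total i j).imp (fun h => hC h) (fun h => hC h)
  · obtain ⟨i, hi⟩ := hS B hB
    obtain ⟨j, hj⟩ := hT B hB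
    refine ⟨_, ⟨max i j, rfl⟩, fun x hx => ?_⟩
    rcases (hST.symm ▸ mem_univ x : x ∈ S ∪ T) with h | h
    · exact mem_biUnion (mem_Iic.2 (le_max_left i j)) (Or.inl (hi ⟨h, hx⟩))
    · exact mem_biUnion (mem_Iic.2 (le_max_right i j)) (Or.inr (hj ⟨h, hx⟩))

/-- The least cardinality of a family of bounded sets that dominates `S`. -/
noncomputable def traceCof (X : Ballean α) (S : Set α) : Cardinal.{u} :=
  sInf {c | ∃ 𝒟, X.Dominates 𝒟 S ∧ Cardinal.mk 𝒟 = c}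

theorem exists_dominates (X : Ballean α) (S : Set α) :
    ∃ 𝒟, X.Dominates 𝒟 S ∧ Cardinal.mk 𝒟 = X.traceCof S :=
  csInf_mem (s := {c | ∃ 𝒟, X.Dominates 𝒟 S ∧ Cardinal.mk 𝒟 = c})
    ⟨_, X.bornology, ⟨Subset.rfl, fun B hB => ⟨B, hB, inter_subset_right⟩⟩, rfl⟩

theorem Dominates.traceCof_le {X : Ballean α} {𝒟 : Set (Set α)} {S : Set α}
    (h : X.Dominates 𝒟 S) : X.traceCof S ≤ Cardinal.mk 𝒟 :=
  csInf_le' ⟨𝒟, h, rfl⟩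

/-- Singletons are bounded, so a dominating family covers `S`; with fewer than `c` members it would
make `S` bounded. -/
theorem IsAdditiveOn.le_traceCof {X : Ballean α} {S : Set α} {c : Cardinal.{u}}
    (h : X.IsAdditiveOn c S) (hS : ¬ X.IsBounded S) : c ≤ X.traceCof S := by
  obtain ⟨𝒟, h𝒟, hc⟩ := X.exists_dominates S
  by_contra! hlt
  refine hS ((h 𝒟 h𝒟.1 (hc ▸ hlt)).mono fun x hx => ⟨hx, ?_⟩)
  obtain ⟨D, hD, hxD⟩ := h𝒟.2 {x} (X.isBounded_singleton x)
  exact ⟨D, hD, hxD ⟨hx, rfl⟩⟩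

/-- A relation between two sets `P`, `S` which forces the cofinality of the trace of the
bornology on one of them to be at most the additivity of the trace on the other. -/
def Interlaced (X : Ballean α) (P S : Set α) : Prop :=
  ∃ f : Set α → Set α, (∀ D, X.IsBounded D → X.IsBounded (f D)) ∧
    ∀ D D', X.IsBounded D → X.IsBounded D' → P ∩ D' ⊆ f D ∨ S ∩ D ⊆ f D'

theorem Interlaced.symm {X : Ballean α} {P S : Set α} (h : X.Interlaced P S) :
    X.Interlaced S P := by
  obtain ⟨f, hf, h⟩ := h
  exact ⟨f, hf, fun D D' hD hD' => (h D' D hD' hD).symm⟩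

/-- Too few sets `f D` cannot dominate `P`, so one bounded `B` has trace on `P` escaping all of
them. Interlacing then puts every `S ∩ D` into the single bounded set `f B`. -/
theorem Interlaced.isAdditiveOn {X : Ballean α} {P S : Set α} (h : X.Interlaced P S) :
    X.IsAdditiveOn (X.traceCof P) S := by
  obtain ⟨f, hf, h⟩ := h
  intro 𝒟 h𝒟 hlt
  have hnd : ¬ X.Dominates (f '' 𝒟) P := fun hd =>
    (hd.traceCof_le.trans Cardinal.mk_image_le).not_gt hlt
  have : ∃ B ∈ X.bornology, ∀ D ∈ 𝒟, ¬ P ∩ B ⊆ f D := by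
    by_contra! hcon
    refine hnd ⟨?_, fun B hB => ?_⟩
    · rintro _ ⟨D, hD, rfl⟩
      exact hf D (h𝒟 hD)
    · obtain ⟨D, hD, hBD⟩ := hcon B hB
      exact ⟨_, mem_image_of_mem f hD, hBD⟩
  obtain ⟨B, hB, hBD⟩ := this
  refine (hf B hB).mono ?_
  rintro x ⟨hxS, D, hD, hxD⟩
  exact (h D B (h𝒟 hD) hB).resolve_left (hBD D hD) ⟨hxS, hxD⟩

theorem Interlaced.traceCof_eq {X : Ballean α} {P S : Set α} (h : X.Interlaced P S)
    (hP : ¬ X.IsBounded P) (hS : ¬ X.IsBounded S) : X.traceCof P = X.traceCof S :=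
  (h.isAdditiveOn.le_traceCof hS).antisymm (h.symm.isAdditiveOn.le_traceCof hP)

/-- Along the path `S`, `P`, `Q`, `T` all trace cofinalities agree. Thus the bornology is additive
up to this cardinal on `S` and on `T`, hence everywhere, and dominating families of `S` and `T` can
share an index set. -/
theorem hasLinearBornologyBase_of_interlaced {X : Ballean α} [Nonempty α] {P Q S T : Set α}
    (hP : ¬ X.IsBounded P) (hQ : ¬ X.IsBounded Q) (hS : ¬ X.IsBounded S) (hT : ¬ X.IsBounded T)
    (hST : S ∪ T = univ) (hPQ : X.Interlaced P Q) (hPS : X.Interlaced P S)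
    (hQT : X.Interlaced Q T) : X.HasLinearBornologyBase := by
  have ePQ := hPQ.traceCof_eq hP hQ
  have ePS := hPS.traceCof_eq hP hS
  have eQT := hQT.traceCof_eq hQ hT
  obtain ⟨𝒟, h𝒟, hc⟩ := X.exists_dominates S
  obtain ⟨𝒟', h𝒟', hc'⟩ := X.exists_dominates T
  obtain ⟨e⟩ : Nonempty (𝒟 ≃ 𝒟') := Cardinal.eq.1 (by rw [hc, hc', ← ePS, ← eQT, ePQ])
  have hadd : X.IsAdditiveOn (Cardinal.mk 𝒟) univ := by
    intro 𝒞 h𝒞 hlt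
    refine ((hPS.isAdditiveOn 𝒞 h𝒞 ?_).union (hQT.isAdditiveOn 𝒞 h𝒞 ?_)).mono ?_
    · rwa [ePS, ← hc]
    · rwa [← ePQ, ePS, ← hc]
    · rw [← union_inter_distrib_right, hST]
  refine hasLinearBornologyBase_of_index hadd hST (D := fun i => i.1) (D' := fun i => (e i).1)
    (fun i => h𝒟.1 i.2) (fun i => h𝒟'.1 (e i).2) (fun B hB => ?_) (fun B hB => ?_)
  · obtain ⟨D, hD, h⟩ := h𝒟.2 B hB
    exact ⟨⟨D, hD⟩, h⟩
  · obtain ⟨D, hD, h⟩ := h𝒟'.2 B hB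
    exact ⟨e.symm ⟨D, hD⟩, by simpa using h⟩

theorem hasLinearBornologyBase_of_isBounded_univ {X : Ballean α} (h : X.IsBounded univ) :
    X.HasLinearBornologyBase :=
  ⟨{univ}, by simpa [bornology] using h, IsChain.singleton, fun B _ => ⟨univ, rfl, subset_univ B⟩⟩

theorem hasLinearBornologyBase_of_interlaced_univ {X : Ballean α} [Nonempty α]
    (h : X.Interlaced univ univ) : X.HasLinearBornologyBase := by
  by_cases hb : X.IsBounded univ
  · exact hasLinearBornologyBase_of_isBounded_univ hb
  · exact hasLinearBornologyBase_of_interlaced hb hb hb hb (union_self _) h h h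

/-- Majorants of too few bounded sets inside the chain are not cofinal: some bounded `B` lies in
none of them. A chain member above `B` is then comparable with each majorant and must contain it. -/
theorem HasLinearBornologyBase.isAdditiveOn {X : Ballean α} (h : X.HasLinearBornologyBase) :
    X.IsAdditiveOn (Order.cof X.bornology) univ := by
  obtain ⟨C, hCX, hchain, hC⟩ := h
  intro 𝒟 h𝒟 hlt
  choose g hgC hg using fun D : 𝒟 => hC D.1 (h𝒟 D.2)
  let s : Set X.bornology := range fun D : 𝒟 => ⟨g D, hCX (hgC D)⟩
  have hs : ¬ IsCofinal s := fun hs =>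
    ((Order.cof_le hs).trans Cardinal.mk_range_le).not_gt hlt
  have : ∃ B ∈ X.bornology, ∀ D : 𝒟, ¬ B ⊆ g D := by
    by_contra! hcon
    refine hs fun B => ?_
    obtain ⟨D, hD⟩ := hcon B.1 B.2
    exact ⟨_, ⟨D, rfl⟩, hD⟩
  obtain ⟨B, hB, hBg⟩ := this
  obtain ⟨K, hK, hBK⟩ := hC B hB
  refine (hCX hK : X.IsBounded K).mono ?_
  rintro x ⟨-, D, hD, hxD⟩
  rcases hchain.total (hgC ⟨D, hD⟩) hK with h | h
  · exact h (hg ⟨D, hD⟩ hxD)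
  · exact absurd (hBK.trans h) (hBg _)

/-- In a cof-regular ballean whose bornology has a linearly ordered base, the entourages have
a base indexed by a linear order with small initial segments. -/
theorem HasLinearBornologyBase.exists_index {X : Ballean α} [Nonempty α]
    (h : X.HasLinearBornologyBase) (hX : X.IsCofRegular) :
    ∃ (ι : Type u) (_ : LinearOrder ι) (E : ι → SetRel α α), (∀ i, E i ∈ X.entourages) ∧
      (∀ F ∈ X.entourages, ∃ i, F ⊆ E i) ∧
      ∀ (i : ι) (B : ι → Set α), (∀ j, X.IsBounded (B j)) → X.IsBounded (⋃ j ∈ Iic i, B j) := by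
  obtain ⟨s, hs, hc⟩ := Order.exists_cof_eq X.entourages
  have hadd := h.isAdditiveOn
  -- Cof-regularity enters here: additivity up to the cofinality of the bornology becomes additivity
  -- up to the size of a base of entourages.
  rw [← hX, ← hc] at hadd
  obtain ⟨L, hL⟩ := hadd.exists_linearOrder
  refine ⟨s, L, fun i => i.1.1, fun i => i.1.2, fun F hF => ?_, hL⟩
  obtain ⟨E, hE, hFE⟩ := hs ⟨F, hF⟩
  exact ⟨⟨E, hE⟩, hFE⟩

/-! ### Balleans of bounded sets -/

/-- The points of the ballean `Y` are described up to a bounded error by non-empty bounded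
subsets `supp y` of `X`, in the way in which this happens in the hyperballean of `X`. -/
structure IsHyperLike (X : Ballean α) (Y : Ballean β) (supp : β → Set α) : Prop where
  isBounded_iff : ∀ W, Y.IsBounded W ↔ X.IsBounded (⋃ w ∈ W, supp w)
  exists_lift : ∃ Φ : SetRel α α → SetRel β β, (∀ E F, E ⊆ F → Φ E ⊆ Φ F) ∧
    (∀ E ∈ X.entourages, Φ E ∈ Y.entourages) ∧ ∀ F ∈ Y.entourages, ∃ E ∈ X.entourages, F ⊆ Φ E
  supp_subset : ∀ F ∈ Y.entourages, ∃ E ∈ X.entourages,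
    ∀ y y', (y, y') ∈ F → supp y' ⊆ SetRel.image E (supp y)

/-- The part of the `E i`-neighborhoods of `A` that is separated from `B`. -/
def separatedNhd {ι : Type u} [LinearOrder ι] (E : ι → SetRel β β) (A B : Set β) : Set β :=
  ⋃ i, (SetRel.image (E i) A \ ⋃ j ∈ Iic i, SetRel.image (E j) B)

theorem disjoint_separatedNhd {ι : Type u} [LinearOrder ι] (E : ι → SetRel β β) (A B : Set β) :
    Disjoint (separatedNhd E A B) (separatedNhd E B A) := by
  rw [Set.disjoint_left]
  intro x hx hx'
  obtain ⟨i, hiA, hiB⟩ := mem_iUnion.1 hx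
  obtain ⟨j, hjB, hjA⟩ := mem_iUnion.1 hx'
  rcases le_total j i with h | h
  · exact hiB (mem_biUnion (mem_Iic.2 h) hjB)
  · exact hjA (mem_biUnion (mem_Iic.2 h) hiA)

/-- The part of `E i [A]` that is missed lies in the union over `j ≤ i` of `E i [A] ∩ E j [B]`. Each
piece is bounded, and the union of their supports over an initial segment is bounded in `X`. -/
theorem IsHyperLike.isAsympNhd_separatedNhd {X : Ballean α} {Y : Ballean β} {supp : β → Set α}
    (hY : X.IsHyperLike Y supp) {ι : Type u} [LinearOrder ι] {E : ι → SetRel β β}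
    (hE : ∀ i, E i ∈ Y.entourages) (hcof : ∀ F ∈ Y.entourages, ∃ i, F ⊆ E i)
    (hι : ∀ (i : ι) (B : ι → Set α), (∀ j, X.IsBounded (B j)) → X.IsBounded (⋃ j ∈ Iic i, B j))
    {A B : Set β} (hAB : Y.AsympDisjoint A B) : Y.IsAsympNhd (separatedNhd E A B) A := by
  intro F hF
  obtain ⟨i, hi⟩ := hcof F hF
  rw [hY.isBounded_iff]
  refine (hι i (fun j => ⋃ w ∈ SetRel.image (E i) A ∩ SetRel.image (E j) B, supp w)
    fun j => ?_).mono ?_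
  · obtain ⟨D, hD, h₁, h₂⟩ := Y.exists_sup (hE i) (hE j)
    rw [← hY.isBounded_iff]
    refine (hAB D hD).mono ?_
    rintro w ⟨⟨a, ha, haw⟩, ⟨b, hb, hbw⟩⟩
    exact ⟨⟨a, ha, h₁ haw⟩, ⟨b, hb, h₂ hbw⟩⟩
  · refine iUnion₂_subset fun w hw => ?_
    obtain ⟨⟨a, ha, haw⟩, hwU⟩ := hw
    have hwA : w ∈ SetRel.image (E i) A := ⟨a, ha, hi haw⟩
    have hwB : w ∈ ⋃ j ∈ Iic i, SetRel.image (E j) B := by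
      by_contra hcon
      exact hwU (mem_iUnion.2 ⟨i, hwA, hcon⟩)
    obtain ⟨j, hj, hwj⟩ := mem_iUnion₂.1 hwB
    exact fun x hx => mem_biUnion hj (mem_biUnion ⟨hwA, hwj⟩ hx)

theorem IsHyperLike.isNormal {X : Ballean α} [Nonempty α] {Y : Ballean β} {supp : β → Set α}
    (hY : X.IsHyperLike Y supp) (hX : X.IsCofRegular) (h : X.HasLinearBornologyBase) :
    Y.IsNormal := by
  obtain ⟨ι, L, E, hE, hcof, hι⟩ := h.exists_index hX
  obtain ⟨Φ, hmono, hΦ, hΦcof⟩ := hY.exists_lift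
  have hcof' : ∀ F ∈ Y.entourages, ∃ i, F ⊆ Φ (E i) := fun F hF => by
    obtain ⟨D, hD, hFD⟩ := hΦcof F hF
    obtain ⟨i, hi⟩ := hcof D hD
    exact ⟨i, hFD.trans (hmono _ _ hi)⟩
  intro A B hAB
  exact ⟨_, _, hY.isAsympNhd_separatedNhd (fun i => hΦ _ (hE i)) hcof' hι hAB,
    hY.isAsympNhd_separatedNhd (fun i => hΦ _ (hE i)) hcof' hι hAB.symm,
    disjoint_separatedNhd _ _ _⟩

/-! ### Pairs of points, and interlacing from normality -/

theorem IsHyperLike.isBounded_setOf_mem_supp {X : Ballean α} {Y : Ballean β} {supp : β → Set α}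
    (hY : X.IsHyperLike Y supp) {W : Set β} (hW : Y.IsBounded W) :
    X.IsBounded {x | ∃ w ∈ W, x ∈ supp w} :=
  ((hY.isBounded_iff W).1 hW).mono fun _ ⟨_, hw, hx⟩ => mem_biUnion hw hx

/-- Points whose supports lie in a common bounded set form a bounded set. -/
theorem IsHyperLike.isBounded_of_supp_subset {X : Ballean α} {Y : Ballean β}
    {supp : β → Set α} (hY : X.IsHyperLike Y supp) {W : Set β} {B : Set α} (hB : X.IsBounded B)
    (h : ∀ w ∈ W, supp w ⊆ B) : Y.IsBounded W :=
  (hY.isBounded_iff W).2 (hB.mono (iUnion₂_subset h))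

/-- A map that realizes the pairs of points of `X` as points of `Y`. -/
structure IsPairing (X : Ballean α) (Y : Ballean β) (supp : β → Set α) (m : α → α → β) : Prop where
  supp_eq : ∀ x y, supp (m x y) = {x, y}
  exists_near : ∀ E ∈ X.entourages, ∃ F ∈ Y.entourages,
    ∀ x x' y y', (x, x') ∈ E → (y, y') ∈ E → (m x y, m x' y') ∈ F

/-- Moving a coordinate from `x₀` to any `y ∈ D` costs one fixed entourage, so the exceptions lie in
a bounded set of `Y`, and their supports contain the offending `p`. The variable `m'` covers both
coordinates. -/
theorem IsPairing.exists_isBounded_diff {X : Ballean α} {Y : Ballean β} {supp : β → Set α}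
    {m : α → α → β} (hm : X.IsPairing Y supp m) {m' : α → α → β}
    (hm' : m' = m ∨ m' = fun x y => m y x) (hY : X.IsHyperLike Y supp) {U : Set β} {P : Set α}
    (x₀ : α) (hU : Y.IsAsympNhd U ((fun p => m' p x₀) '' P)) {D : Set α} (hD : X.IsBounded D) :
    ∃ K, X.IsBounded K ∧ ∀ p ∈ P, p ∉ K → ∀ y ∈ D, m' p y ∈ U := by
  obtain ⟨E, hE, hDE⟩ := hD.exists_center x₀
  obtain ⟨F, hF, hEF⟩ := hm.exists_near E hE
  refine ⟨_, hY.isBounded_setOf_mem_supp (hU F hF), fun p hp hpK y hy => ?_⟩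
  by_contra hcon
  refine hpK ⟨m' p y, ⟨⟨_, mem_image_of_mem _ hp, ?_⟩, hcon⟩, ?_⟩
  · rcases hm' with rfl | rfl
    · exact hEF _ _ _ _ (X.refl_mem E hE p) (hDE y hy)
    · exact hEF _ _ _ _ (hDE y hy) (X.refl_mem E hE p)
  · rcases hm' with rfl | rfl <;> simp [hm.supp_eq]

/-- If some `p ∈ P ∩ D'` and `s ∈ S ∩ D` both escaped, `m p s` would lie in `U` because `s ∈ D`, and
in `V` because `p ∈ D'`. -/
theorem IsPairing.interlaced {X : Ballean α} {Y : Ballean β} {supp : β → Set α}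
    {m : α → α → β} (hm : X.IsPairing Y supp m) (hY : X.IsHyperLike Y supp) (hN : Y.IsNormal)
    {P S : Set α} (x₀ : α)
    (hPS : Y.AsympDisjoint ((fun p => m p x₀) '' P) ((fun s => m x₀ s) '' S)) :
    X.Interlaced P S := by
  obtain ⟨U, V, hU, hV, hUV⟩ := hN _ _ hPS
  choose! f hf hfU using fun D (hD : X.IsBounded D) =>
    hm.exists_isBounded_diff (Or.inl rfl) hY x₀ hU hD
  choose! g hg hgV using fun D (hD : X.IsBounded D) =>
    hm.exists_isBounded_diff (m' := fun x y => m y x) (Or.inr rfl) hY x₀ hV hD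
  refine ⟨fun D => f D ∪ g D, fun D hD => (hf D hD).union (hg D hD), fun D D' hD hD' => ?_⟩
  by_contra! hcon
  obtain ⟨⟨p, ⟨hpP, hpD'⟩, hpf⟩, ⟨s, ⟨hsS, hsD⟩, hsf⟩⟩ :=
    And.intro (not_subset.1 hcon.1) (not_subset.1 hcon.2)
  exact Set.disjoint_left.1 hUV (hfU D hD p hpP (fun h => hpf (Or.inl h)) s hsD)
    (hgV D' hD' s hsS (fun h => hsf (Or.inr h)) p hpD')

theorem IsPairing.asympDisjoint {X : Ballean α} {Y : Ballean β} {supp : β → Set α}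
    {m : α → α → β} (hm : X.IsPairing Y supp m) (hY : X.IsHyperLike Y supp) {P S : Set α}
    (x₀ : α) (hPS : X.AsympDisjoint P S) :
    Y.AsympDisjoint ((fun p => m p x₀) '' P) ((fun s => m x₀ s) '' S) := by
  intro F hF
  obtain ⟨E, hE, h⟩ := hY.supp_subset F hF
  refine hY.isBounded_of_supp_subset ((hPS E hE).union ((X.isBounded_singleton x₀).image hE)) ?_
  rintro w ⟨⟨_, ⟨p, hp, rfl⟩, hpw⟩, ⟨_, ⟨s, hs, rfl⟩, hsw⟩⟩ x hx
  obtain ⟨a, ha, hax⟩ := h _ _ hpw hx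
  obtain ⟨b, hb, hbx⟩ := h _ _ hsw hx
  simp only [hm.supp_eq, mem_insert_iff, mem_singleton_iff] at ha hb
  rcases ha with rfl | rfl
  · rcases hb with rfl | rfl
    · exact Or.inr ⟨_, rfl, hbx⟩
    · exact Or.inl ⟨⟨_, hp, hax⟩, ⟨_, hs, hbx⟩⟩
  · exact Or.inr ⟨_, rfl, hax⟩

/-- If `Y` is normal, so is `X`, which embeds into `Y` as the diagonal. -/
theorem IsPairing.isNormal {X : Ballean α} {Y : Ballean β} {supp : β → Set α}
    {m : α → α → β} (hm : X.IsPairing Y supp m) (hY : X.IsHyperLike Y supp) (hN : Y.IsNormal) :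
    X.IsNormal := by
  have hsupp : ∀ x, supp (m x x) = {x} := fun x => by simp [hm.supp_eq]
  intro A B hAB
  have hdisj : Y.AsympDisjoint ((fun x => m x x) '' A) ((fun x => m x x) '' B) := by
    intro F hF
    obtain ⟨E, hE, h⟩ := hY.supp_subset F hF
    refine hY.isBounded_of_supp_subset (hAB E hE) ?_
    rintro w ⟨⟨_, ⟨p, hp, rfl⟩, hpw⟩, ⟨_, ⟨s, hs, rfl⟩, hsw⟩⟩ x hx
    obtain ⟨a, ha, hax⟩ := h _ _ hpw hx
    obtain ⟨b, hb, hbx⟩ := h _ _ hsw hx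
    simp only [hsupp, mem_singleton_iff] at ha hb
    subst ha hb
    exact ⟨⟨_, hp, hax⟩, ⟨_, hs, hbx⟩⟩
  have key : ∀ (A : Set α) (U : Set β), Y.IsAsympNhd U ((fun x => m x x) '' A) →
      X.IsAsympNhd {x | m x x ∈ U} A := by
    intro A U hU E hE
    obtain ⟨F, hF, hEF⟩ := hm.exists_near E hE
    refine (hY.isBounded_setOf_mem_supp (hU F hF)).mono ?_
    rintro x ⟨⟨a, ha, hax⟩, hx⟩
    exact ⟨m x x, ⟨⟨_, mem_image_of_mem _ ha, hEF _ _ _ _ hax hax⟩, hx⟩, by simp [hsupp]⟩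
  obtain ⟨U, V, hU, hV, hUV⟩ := hN _ _ hdisj
  exact ⟨_, _, key A U hU, key B V hV, hUV.preimage _⟩

/-- Normality descends to `X`, so `P` and `Q` have disjoint asymptotic neighborhoods `U`, `V`. The
complements of `U` and `V` cover `X` and are asymptotically disjoint from `P` and `Q` respectively,
which gives the required path of interlaced sets. -/
theorem IsPairing.hasLinearBornologyBase {X : Ballean α} [Nonempty α] {Y : Ballean β}
    {supp : β → Set α} {m : α → α → β} (hm : X.IsPairing Y supp m) (hY : X.IsHyperLike Y supp)
    (hN : Y.IsNormal) (hX : ¬ X.IsUltranormal) : X.HasLinearBornologyBase := by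
  obtain ⟨P, Q, hP, hQ, hPQ⟩ := not_not.1 hX
  obtain ⟨x₀⟩ := ‹Nonempty α›
  obtain ⟨U, V, hU, hV, hUV⟩ := hm.isNormal hY hN P Q hPQ
  have hint : ∀ {S T : Set α}, X.AsympDisjoint S T → X.Interlaced S T := fun h =>
    hm.interlaced hY hN x₀ (hm.asympDisjoint hY x₀ h)
  refine hasLinearBornologyBase_of_interlaced hP hQ (S := Uᶜ) (T := Vᶜ) (fun hb => ?_)
    (fun hb => ?_) ?_ (hint hPQ) (hint hU.asympDisjoint_compl) (hint hV.asympDisjoint_compl)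
  -- `Q` lies in `V` up to a bounded set and `V ⊆ Uᶜ`, so a bounded `Uᶜ` would make `Q` bounded.
  · refine hQ ((hV.isBounded_diff.union hb).mono fun q hq => ?_)
    by_cases h : q ∈ V
    · exact Or.inr (Set.disjoint_right.1 hUV h)
    · exact Or.inl ⟨hq, h⟩
  · refine hP ((hU.isBounded_diff.union hb).mono fun q hq => ?_)
    by_cases h : q ∈ U
    · exact Or.inr (Set.disjoint_left.1 hUV h)
    · exact Or.inl ⟨hq, h⟩
  · rw [← compl_inter, hUV.inter_eq, compl_empty]

theorem IsPairing.hasLinearBornologyBase_of_asympDisjoint {X : Ballean α} [Nonempty α]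
    {Y : Ballean β} {supp : β → Set α} {m : α → α → β} (hm : X.IsPairing Y supp m)
    (hY : X.IsHyperLike Y supp) (hN : Y.IsNormal) (x₀ : α)
    (h : Y.AsympDisjoint (range fun x => m x x₀) (range fun x => m x₀ x)) :
    X.HasLinearBornologyBase :=
  hasLinearBornologyBase_of_interlaced_univ
    (hm.interlaced hY hN x₀ (by simpa only [image_univ] using h))

/-! ### The hyperballean and its subballeans -/

theorem isHyperLike_hyperballean (X : Ballean α) [Nonempty α] :
    X.IsHyperLike X.hyperballean Subtype.val where
  isBounded_iff W := by
    constructor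
    · rintro ⟨_, ⟨E, hE, rfl⟩, A, hA⟩
      exact (A.2.2.image hE).mono (iUnion₂_subset fun w hw => (hA hw).2)
    · rintro ⟨E, hE, x, hx⟩
      obtain ⟨D, hD, hED, hinv⟩ := X.exists_inv hE hE
      refine ⟨_, ⟨D, hD, rfl⟩, ⟨{x}, singleton_nonempty x, X.isBounded_singleton x⟩, ?_⟩
      intro w hw
      have hwE : ∀ y ∈ w.1, (x, y) ∈ E := fun y hy => hx (mem_biUnion hw hy)
      refine ⟨?_, fun y hy => ⟨x, rfl, hED (hwE y hy)⟩⟩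
      rintro _ rfl
      obtain ⟨y, hy⟩ := w.2.1
      exact ⟨y, hy, hinv _ _ (hwE y hy)⟩
  exists_lift := by
    refine ⟨fun E => {p | p.1.1 ⊆ SetRel.image E p.2.1 ∧ p.2.1 ⊆ SetRel.image E p.1.1},
      fun E F hEF => ?_, fun E hE => ⟨E, hE, rfl⟩, ?_⟩
    · have : ∀ A : Set α, SetRel.image E A ⊆ SetRel.image F A :=
        fun A y ⟨a, ha, hay⟩ => ⟨a, ha, hEF hay⟩
      exact fun p hp => ⟨hp.1.trans (this _), hp.2.trans (this _)⟩
    · rintro _ ⟨E, hE, rfl⟩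
      exact ⟨E, hE, Subset.rfl⟩
  supp_subset := by
    rintro _ ⟨E, hE, rfl⟩
    exact ⟨E, hE, fun A B h => h.2⟩

/-- The pair `{x, y}` as a point of the hyperballean. -/
def hyperPair (X : Ballean α) (x y : α) : X.Hyper :=
  ⟨{x, y}, insert_nonempty _ _, (X.isBounded_singleton x).union (X.isBounded_singleton y)⟩

theorem isPairing_hyperballean (X : Ballean α) :
    X.IsPairing X.hyperballean Subtype.val X.hyperPair where
  supp_eq _ _ := rfl
  exists_near E hE := by
    obtain ⟨D, hD, hED, hinv⟩ := X.exists_inv hE hE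
    refine ⟨_, ⟨D, hD, rfl⟩, fun x x' y y' hx hy => ⟨?_, ?_⟩⟩
    · rintro z (rfl | rfl)
      · exact ⟨x', Or.inl rfl, hinv _ _ hx⟩
      · exact ⟨y', Or.inr rfl, hinv _ _ hy⟩
    · rintro z (rfl | rfl)
      · exact ⟨x, Or.inl rfl, hED hx⟩
      · exact ⟨y, Or.inr rfl, hED hy⟩

theorem isBounded_restrict_iff {Y : Ballean β} {Z : Set β} (hZ : Z.Nonempty) {W : Set Z} :
    (Y.restrict Z).IsBounded W ↔ Y.IsBounded (Subtype.val '' W) := by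
  constructor
  · rintro ⟨_, ⟨E, hE, rfl⟩, x, hx⟩
    exact ⟨E, hE, x, by rintro _ ⟨w, hw, rfl⟩; exact hx hw⟩
  · intro h
    obtain ⟨z, hz⟩ := hZ
    obtain ⟨E, hE, hzE⟩ := h.exists_center z
    exact ⟨_, ⟨E, hE, rfl⟩, ⟨z, hz⟩, fun w hw => hzE _ (mem_image_of_mem _ hw)⟩

theorem IsHyperLike.restrict {X : Ballean α} {Y : Ballean β} {supp : β → Set α}
    (hY : X.IsHyperLike Y supp) {Z : Set β} (hZ : Z.Nonempty) :
    X.IsHyperLike (Y.restrict Z) (fun z => supp z) where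
  isBounded_iff W := by
    rw [isBounded_restrict_iff hZ, hY.isBounded_iff, biUnion_image]
  exists_lift := by
    obtain ⟨Φ, hmono, hΦ, hcof⟩ := hY.exists_lift
    refine ⟨fun E => {p | ((p.1 : β), (p.2 : β)) ∈ Φ E}, fun E F h p hp => hmono _ _ h hp,
      fun E hE => ⟨_, hΦ E hE, rfl⟩, ?_⟩
    rintro _ ⟨F, hF, rfl⟩
    obtain ⟨E, hE, h⟩ := hcof F hF
    exact ⟨E, hE, fun p hp => h hp⟩
  supp_subset := by
    rintro _ ⟨F, hF, rfl⟩
    obtain ⟨E, hE, h⟩ := hY.supp_subset F hF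
    exact ⟨E, hE, fun y y' hyy' => h _ _ hyy'⟩

theorem IsPairing.restrict {X : Ballean α} {Y : Ballean β} {supp : β → Set α}
    {m : α → α → β} (hm : X.IsPairing Y supp m) {Z : Set β} (hZ : ∀ x y, m x y ∈ Z) :
    X.IsPairing (Y.restrict Z) (fun z => supp z) (fun x y => ⟨m x y, hZ x y⟩) where
  supp_eq := hm.supp_eq
  exists_near E hE := by
    obtain ⟨F, hF, h⟩ := hm.exists_near E hE
    exact ⟨_, ⟨F, hF, rfl⟩, h⟩

theorem hyperPair_mem (X : Ballean α) {n : ℕ} (hn : 2 ≤ n) (x y : α) :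
    X.hyperPair x y ∈ {A : X.Hyper | (A : Set α).encard ≤ n} :=
  (encard_insert_le {y} x).trans (by
    rw [encard_singleton, one_add_one_eq_two]
    exact_mod_cast hn)

theorem nonempty_encard_le (X : Ballean α) [Nonempty α] {n : ℕ} (hn : 1 ≤ n) :
    {A : X.Hyper | (A : Set α).encard ≤ n}.Nonempty := by
  obtain ⟨x⟩ := ‹Nonempty α›
  refine ⟨⟨{x}, singleton_nonempty x, X.isBounded_singleton x⟩, ?_⟩
  simpa using hn

/-! ### Powers and symmetric powers -/

variable {n : ℕ}

/-- The relation on `G`-classes induced by a relation on `αⁿ`. -/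
def symRel (G : Subgroup (Equiv.Perm (Fin n))) (E : SetRel (Fin n → α) (Fin n → α)) :
    SetRel (Quotient (permSetoid α G)) (Quotient (permSetoid α G)) :=
  {q | ∃ x y : Fin n → α, (x, y) ∈ E ∧ q = (permClass G x, permClass G y)}

theorem symRel_mono (G : Subgroup (Equiv.Perm (Fin n))) {E F : SetRel (Fin n → α) (Fin n → α)}
    (h : E ⊆ F) : symRel G E ⊆ symRel G F :=
  fun _ ⟨x, y, hxy, hq⟩ => ⟨x, y, h hxy, hq⟩

/-- The support of a class `xG`. -/
def symSupp (G : Subgroup (Equiv.Perm (Fin n))) (q : Quotient (permSetoid α G)) : Set α :=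
  Quotient.lift (fun x : Fin n → α => range x) (by
    rintro x _ ⟨g, -, rfl⟩
    exact (g.surjective.range_comp x).symm) q

theorem permClass_surjective (G : Subgroup (Equiv.Perm (Fin n))) :
    Function.Surjective (permClass (α := α) G) := Quotient.mk_surjective

theorem prodRel_mem_power (X : Ballean α) {E : SetRel α α} (hE : E ∈ X.entourages) :
    (prodRel fun _ : Fin n => E) ∈ (X.power n).entourages :=
  ⟨fun _ => E, fun _ => hE, rfl⟩

theorem exists_subset_prodRel (X : Ballean α) [Nonempty α] {F : SetRel (Fin n → α) (Fin n → α)}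
    (hF : F ∈ (X.power n).entourages) :
    ∃ E ∈ X.entourages, F ⊆ prodRel fun _ : Fin n => E := by
  obtain ⟨E, hE, rfl⟩ := hF
  -- An entourage is needed even when `n = 0`.
  obtain ⟨E₀, hE₀⟩ := X.entourages_nonempty
  obtain ⟨D, hD, h⟩ := X.exists_bound hE₀ n E hE
  exact ⟨D, hD, fun p hp i => h i (hp i)⟩

theorem isHyperLike_power (X : Ballean α) [Nonempty α] :
    X.IsHyperLike (X.power n) (fun x => range x) where
  isBounded_iff W := by
    constructor
    · rintro ⟨F, hF, x, hx⟩
      obtain ⟨E, hE, hFE⟩ := X.exists_subset_prodRel hF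
      have hb : X.IsBounded (range x) := by
        rw [← biUnion_of_singleton (range x)]
        exact isBounded_biUnion (toFinite _) fun i _ => X.isBounded_singleton i
      refine (hb.image hE).mono (iUnion₂_subset ?_)
      rintro w hw _ ⟨i, rfl⟩
      exact ⟨x i, mem_range_self i, hFE (hx hw) i⟩
    · rintro ⟨E, hE, x, hx⟩
      exact ⟨_, X.prodRel_mem_power hE, fun _ => x,
        fun w hw i => hx (mem_biUnion hw (mem_range_self i))⟩
  exists_lift :=
    ⟨fun E => prodRel fun _ => E, fun _ _ h _ hp i => h (hp i),
      fun _ hE => X.prodRel_mem_power hE, fun _ hF => X.exists_subset_prodRel hF⟩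
  supp_subset F hF := by
    obtain ⟨E, hE, hFE⟩ := X.exists_subset_prodRel hF
    refine ⟨E, hE, ?_⟩
    rintro x y hxy _ ⟨i, rfl⟩
    exact ⟨x i, mem_range_self i, hFE hxy i⟩

theorem IsHyperLike.symPower {X : Ballean α} (G : Subgroup (Equiv.Perm (Fin n)))
    (h : X.IsHyperLike (X.power n) (fun x => range x)) :
    X.IsHyperLike (X.symPower G) (symSupp G) where
  isBounded_iff W := by
    have hW : (⋃ w ∈ W, symSupp G w) = ⋃ x ∈ permClass G ⁻¹' W, range x := by
      refine Subset.antisymm (iUnion₂_subset fun w hw => ?_)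
        (iUnion₂_subset fun x hx => subset_biUnion_of_mem (u := symSupp G) hx)
      obtain ⟨x, rfl⟩ := permClass_surjective G w
      exact subset_biUnion_of_mem (u := fun x : Fin n → α => range x) hw
    constructor
    · rintro ⟨_, ⟨F, hF, rfl⟩, q, hq⟩
      obtain ⟨c, rfl⟩ := permClass_surjective G q
      obtain ⟨E, hE, hFE⟩ := h.supp_subset F hF
      have hb : X.IsBounded (range c) := by
        simpa using (h.isBounded_iff {c}).1 ((X.power n).isBounded_singleton c)
      refine (hb.image hE).mono (iUnion₂_subset fun w hw => ?_)
      obtain ⟨x, y, hxy, he⟩ := hq hw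
      obtain ⟨he₁, rfl⟩ := Prod.mk.inj he
      -- The representative `x` varies with `w`, but its range is that of the fixed centre `c`.
      have hcx : range c = range x := congrArg (symSupp G) he₁
      rw [hcx]
      exact hFE _ _ hxy
    · intro hb
      rw [hW, ← h.isBounded_iff] at hb
      obtain ⟨F, hF, x, hx⟩ := hb
      refine ⟨_, ⟨F, hF, rfl⟩, permClass G x, fun w hw => ?_⟩
      obtain ⟨y, rfl⟩ := permClass_surjective G w
      exact ⟨x, y, hx hw, rfl⟩
  exists_lift := by
    obtain ⟨Φ, hmono, hΦ, hcof⟩ := h.exists_lift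
    refine ⟨fun E => symRel G (Φ E), fun E F hEF => symRel_mono G (hmono _ _ hEF),
      fun E hE => ⟨_, hΦ E hE, rfl⟩, ?_⟩
    rintro _ ⟨F, hF, rfl⟩
    obtain ⟨E, hE, hFE⟩ := hcof F hF
    exact ⟨E, hE, symRel_mono G hFE⟩
  supp_subset := by
    rintro _ ⟨F, hF, rfl⟩
    obtain ⟨E, hE, hFE⟩ := h.supp_subset F hF
    refine ⟨E, hE, ?_⟩
    rintro _ _ ⟨x, y, hxy, he⟩
    obtain ⟨rfl, rfl⟩ := Prod.mk.inj he
    exact hFE _ _ hxy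

/-- The point `(x, y, …, y)`, with `x` in position `k`. -/
def powerPair (k : Fin n) (x y : α) : Fin n → α := fun i => if i = k then x else y

theorem range_powerPair (hn : 2 ≤ n) (k : Fin n) (x y : α) : range (powerPair k x y) = {x, y} := by
  have : Nontrivial (Fin n) := Fin.nontrivial_iff_two_le.2 hn
  obtain ⟨j, hj⟩ := exists_ne k
  refine Subset.antisymm ?_ ?_
  · rintro _ ⟨i, rfl⟩
    by_cases h : i = k <;> simp [powerPair, h]
  · rintro _ (rfl | rfl)
    · exact ⟨k, by simp [powerPair]⟩
    · exact ⟨j, by simp [powerPair, hj]⟩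

theorem isPairing_power (X : Ballean α) (hn : 2 ≤ n) (k : Fin n) :
    X.IsPairing (X.power n) (fun x => range x) (powerPair k) where
  supp_eq := range_powerPair hn k
  exists_near E hE := by
    refine ⟨_, X.prodRel_mem_power hE, fun x x' y y' hx hy i => ?_⟩
    by_cases h : i = k <;> simp [powerPair, h, hx, hy]

theorem IsPairing.symPower {X : Ballean α} (G : Subgroup (Equiv.Perm (Fin n)))
    {m : α → α → Fin n → α} (h : X.IsPairing (X.power n) (fun x => range x) m) :
    X.IsPairing (X.symPower G) (symSupp G) (fun x y => permClass G (m x y)) where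
  supp_eq := h.supp_eq
  exists_near E hE := by
    obtain ⟨F, hF, hEF⟩ := h.exists_near E hE
    exact ⟨_, ⟨F, hF, rfl⟩, fun x x' y y' hx hy => ⟨_, _, hEF _ _ _ _ hx hy, rfl⟩⟩

/-- At each position one of the two axes has the constant value `x₀`, so a tuple near both has all
its coordinates near `x₀`. -/
theorem asympDisjoint_power (X : Ballean α) [Nonempty α] (k : Fin n) (x₀ : α) :
    (X.power n).AsympDisjoint (range fun x => powerPair k x x₀)
      (range fun x => powerPair k x₀ x) := by
  intro F hF
  obtain ⟨E, hE, hFE⟩ := X.exists_subset_prodRel hF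
  refine X.isHyperLike_power.isBounded_of_supp_subset ((X.isBounded_singleton x₀).image hE) ?_
  rintro w ⟨⟨_, ⟨x, rfl⟩, hxw⟩, ⟨_, ⟨y, rfl⟩, hyw⟩⟩ _ ⟨i, rfl⟩
  by_cases h : i = k
  · exact ⟨x₀, rfl, by simpa [powerPair, h] using hFE hyw i⟩
  · exact ⟨x₀, rfl, by simpa [powerPair, h] using hFE hxw i⟩

theorem exists_perm_of_mem_symRel {G : Subgroup (Equiv.Perm (Fin n))} {E : SetRel α α}
    {x v : Fin n → α} (h : (permClass G x, permClass G v) ∈ symRel G (prodRel fun _ => E)) :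
    ∃ g : Equiv.Perm (Fin n), ∀ i, (x (g i), v i) ∈ E := by
  obtain ⟨y, w, hyw, he⟩ := h
  obtain ⟨hxy, hvw⟩ := Prod.mk.inj he
  obtain ⟨g, -, rfl⟩ := permClass_eq hxy
  obtain ⟨g', -, rfl⟩ := permClass_eq hvw.symm
  exact ⟨g'.trans g, fun i => hyw (g' i)⟩

/-- Only the coordinate `i` of `v` with `g i = k` can be far from `x₀`. If it is matched with `y`, a
third position `c` is matched with both `x₀` and `y`, so `y`, and with it `v i`, is near `x₀`. For
`n = 2` there may be no such `c`. -/
theorem asympDisjoint_symPower (X : Ballean α) [Nonempty α] (hn : 3 ≤ n)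
    (G : Subgroup (Equiv.Perm (Fin n))) (k : Fin n) (x₀ : α) :
    (X.symPower G).AsympDisjoint (range fun x => permClass G (powerPair k x x₀))
      (range fun x => permClass G (powerPair k x₀ x)) := by
  rintro _ ⟨F, hF, rfl⟩
  obtain ⟨E, hE, hFE⟩ := X.exists_subset_prodRel hF
  obtain ⟨D, hD, hED, hinv⟩ := X.exists_inv hE hE
  have hb := (X.isBounded_singleton x₀).image hE
  refine (X.isHyperLike_power.symPower G).isBounded_of_supp_subset
    (hb.union ((hb.image hD).image hE)) ?_
  rintro q ⟨⟨_, ⟨x, rfl⟩, hxq⟩, ⟨_, ⟨y, rfl⟩, hyq⟩⟩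
  obtain ⟨v, rfl⟩ := permClass_surjective G q
  obtain ⟨g, hg⟩ := exists_perm_of_mem_symRel (symRel_mono G hFE hxq)
  obtain ⟨g', hg'⟩ := exists_perm_of_mem_symRel (symRel_mono G hFE hyq)
  have near : ∀ i, g i ≠ k → (x₀, v i) ∈ E := fun i hi => by simpa [powerPair, hi] using hg i
  have near' : ∀ i, g' i ≠ k → (y, v i) ∈ E := fun i hi => by simpa [powerPair, hi] using hg' i
  rintro _ ⟨i, rfl⟩
  by_cases hi : g i = k
  · by_cases hi' : g' i = k
    · exact Or.inl ⟨x₀, rfl, by simpa [powerPair, hi'] using hg' i⟩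
    · obtain ⟨c, hc⟩ : ∃ c, c ∉ ({i, g'.symm k} : Finset (Fin n)) := by
        by_contra! hcon
        have : n ≤ 2 := by
          simpa [Finset.eq_univ_of_forall hcon] using
            Finset.card_le_two (a := i) (b := g'.symm k)
        omega
      simp only [Finset.mem_insert, Finset.mem_singleton, not_or] at hc
      have hgc : g c ≠ k := fun h => hc.1 (g.injective (h.trans hi.symm))
      have hgc' : g' c ≠ k := fun h => hc.2 (g'.eq_symm_apply.2 h)
      exact Or.inr ⟨y, ⟨v c, ⟨x₀, rfl, near c hgc⟩, hinv _ _ (near' c hgc')⟩, near' i hi'⟩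
  · exact Or.inl ⟨x₀, rfl, near i hi⟩

/-! ### Normality and linearly ordered bases -/

/-- A ball needs a centre, so not even the empty set is bounded and the empty chain is a base. -/
theorem hasLinearBornologyBase_of_isEmpty [IsEmpty α] (X : Ballean α) :
    X.HasLinearBornologyBase :=
  ⟨∅, empty_subset _, IsChain.empty, fun _ ⟨_, _, x, _⟩ => isEmptyElim x⟩

theorem HasLinearBornologyBase.isNormal_power {X : Ballean α} (h : X.HasLinearBornologyBase)
    (hX : X.IsCofRegular) (hn : 1 ≤ n) : (X.power n).IsNormal := by
  rcases isEmpty_or_nonempty α with hα | hα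
  · have : IsEmpty (Fin n → α) := ⟨fun x => isEmptyElim (x ⟨0, hn⟩)⟩
    exact isNormal_of_isEmpty _
  · exact X.isHyperLike_power.isNormal hX h

theorem HasLinearBornologyBase.isNormal_symPower {X : Ballean α} (h : X.HasLinearBornologyBase)
    (hX : X.IsCofRegular) (hn : 1 ≤ n) (G : Subgroup (Equiv.Perm (Fin n))) :
    (X.symPower G).IsNormal := by
  rcases isEmpty_or_nonempty α with hα | hα
  · have : IsEmpty (Quotient (permSetoid α G)) :=
      ⟨fun q => isEmptyElim ((permClass_surjective G q).choose ⟨0, hn⟩)⟩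
    exact isNormal_of_isEmpty _
  · exact (X.isHyperLike_power.symPower G).isNormal hX h

theorem HasLinearBornologyBase.isNormal_hyperballean {X : Ballean α}
    (h : X.HasLinearBornologyBase) (hX : X.IsCofRegular) : X.hyperballean.IsNormal := by
  rcases isEmpty_or_nonempty α with hα | hα
  · have : IsEmpty X.Hyper := ⟨fun A => isEmptyElim A.2.1.some⟩
    exact isNormal_of_isEmpty _
  · exact X.isHyperLike_hyperballean.isNormal hX h

theorem HasLinearBornologyBase.isNormal_hyperSymPower {X : Ballean α}
    (h : X.HasLinearBornologyBase) (hX : X.IsCofRegular) (hn : 1 ≤ n) :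
    (X.hyperSymPower n).IsNormal := by
  rcases isEmpty_or_nonempty α with hα | hα
  · have : IsEmpty {A : X.Hyper | (A : Set α).encard ≤ n} :=
      ⟨fun A => isEmptyElim A.1.2.1.some⟩
    exact isNormal_of_isEmpty _
  · exact (X.isHyperLike_hyperballean.restrict (X.nonempty_encard_le hn)).isNormal hX h

/-! ### From normality of each construction back to a linear base -/

theorem hasLinearBornologyBase_of_isNormal_power {X : Ballean α} (hn : 2 ≤ n)
    (h : (X.power n).IsNormal) : X.HasLinearBornologyBase := by
  rcases isEmpty_or_nonempty α with hα | ⟨⟨x₀⟩⟩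
  · exact X.hasLinearBornologyBase_of_isEmpty
  · have : Nonempty α := ⟨x₀⟩
    let k : Fin n := ⟨0, by omega⟩
    exact (X.isPairing_power hn k).hasLinearBornologyBase_of_asympDisjoint
      X.isHyperLike_power h x₀ (X.asympDisjoint_power k x₀)

theorem hasLinearBornologyBase_of_isNormal_symPower {X : Ballean α} (hn : 3 ≤ n)
    {G : Subgroup (Equiv.Perm (Fin n))} (h : (X.symPower G).IsNormal) :
    X.HasLinearBornologyBase := by
  rcases isEmpty_or_nonempty α with hα | ⟨⟨x₀⟩⟩
  · exact X.hasLinearBornologyBase_of_isEmpty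
  · have : Nonempty α := ⟨x₀⟩
    let k : Fin n := ⟨0, by omega⟩
    exact ((X.isPairing_power (by omega) k).symPower G).hasLinearBornologyBase_of_asympDisjoint
      (X.isHyperLike_power.symPower G) h x₀ (X.asympDisjoint_symPower hn G k x₀)

theorem hasLinearBornologyBase_of_isNormal_symPower_of_not_isUltranormal {X : Ballean α}
    (hX : ¬ X.IsUltranormal) (hn : 2 ≤ n) {G : Subgroup (Equiv.Perm (Fin n))}
    (h : (X.symPower G).IsNormal) : X.HasLinearBornologyBase := by
  rcases isEmpty_or_nonempty α with hα | hα
  · exact X.hasLinearBornologyBase_of_isEmpty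
  · exact ((X.isPairing_power hn ⟨0, by omega⟩).symPower G).hasLinearBornologyBase
      (X.isHyperLike_power.symPower G) h hX

theorem hasLinearBornologyBase_of_isNormal_hyperballean {X : Ballean α}
    (hX : ¬ X.IsUltranormal) (h : X.hyperballean.IsNormal) : X.HasLinearBornologyBase := by
  rcases isEmpty_or_nonempty α with hα | hα
  · exact X.hasLinearBornologyBase_of_isEmpty
  · exact X.isPairing_hyperballean.hasLinearBornologyBase X.isHyperLike_hyperballean h hX

theorem hasLinearBornologyBase_of_isNormal_hyperSymPower {X : Ballean α}
    (hX : ¬ X.IsUltranormal) (hn : 2 ≤ n) (h : (X.hyperSymPower n).IsNormal) :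
    X.HasLinearBornologyBase := by
  rcases isEmpty_or_nonempty α with hα | hα
  · exact X.hasLinearBornologyBase_of_isEmpty
  · exact (X.isPairing_hyperballean.restrict (X.hyperPair_mem hn)).hasLinearBornologyBase
      (X.isHyperLike_hyperballean.restrict (X.nonempty_encard_le (by omega))) h hX

end Ballean

theorem theorem1p12 {α : Type*} (X : Ballean α) (hX : X.IsCofRegular) :
    List.TFAE [
      -- (1) all `G`-symmetric powers
      ∀ n : ℕ, 1 ≤ n → ∀ G : Subgroup (Equiv.Perm (Fin n)), (X.symPower G).IsNormal,
      -- (2) some `G`-symmetric power with `n ≥ 3`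
      ∃ n : ℕ, 3 ≤ n ∧ ∃ G : Subgroup (Equiv.Perm (Fin n)), (X.symPower G).IsNormal,
      -- (3) all powers
      ∀ n : ℕ, 1 ≤ n → (X.power n).IsNormal,
      -- (4) some power with `n ≥ 2`
      ∃ n : ℕ, 2 ≤ n ∧ (X.power n).IsNormal,
      -- (5) the bornology has a linearly ordered base
      X.HasLinearBornologyBase] ∧
    (¬ X.IsUltranormal →
      List.TFAE [
        ∀ n : ℕ, 1 ≤ n → ∀ G : Subgroup (Equiv.Perm (Fin n)), (X.symPower G).IsNormal,
        ∃ n : ℕ, 3 ≤ n ∧ ∃ G : Subgroup (Equiv.Perm (Fin n)), (X.symPower G).IsNormal,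
        ∀ n : ℕ, 1 ≤ n → (X.power n).IsNormal,
        ∃ n : ℕ, 2 ≤ n ∧ (X.power n).IsNormal,
        X.HasLinearBornologyBase,
        -- (6) some `G`-symmetric power with `n ≥ 2`
        ∃ n : ℕ, 2 ≤ n ∧ ∃ G : Subgroup (Equiv.Perm (Fin n)), (X.symPower G).IsNormal,
        -- (7) the symmetric square
        (X.symPower (⊤ : Subgroup (Equiv.Perm (Fin 2)))).IsNormal,
        -- (8) the hypersymmetric square
        (X.hyperSymPower 2).IsNormal,
        -- (9) some hypersymmetric power with `n ≥ 2`
        ∃ n : ℕ, 2 ≤ n ∧ (X.hyperSymPower n).IsNormal,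
        -- (10) all hypersymmetric powers
        ∀ n : ℕ, 1 ≤ n → (X.hyperSymPower n).IsNormal,
        -- (11) the hyperballean
        X.hyperballean.IsNormal]) := by
  have h₁ : (∀ n : ℕ, 1 ≤ n → ∀ G : Subgroup (Equiv.Perm (Fin n)), (X.symPower G).IsNormal) ↔
      X.HasLinearBornologyBase :=
    ⟨fun h => Ballean.hasLinearBornologyBase_of_isNormal_symPower le_rfl (h 3 (by norm_num) ⊤),
      fun h _ hn G => h.isNormal_symPower hX hn G⟩
  have h₂ : (∃ n : ℕ, 3 ≤ n ∧ ∃ G : Subgroup (Equiv.Perm (Fin n)), (X.symPower G).IsNormal) ↔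
      X.HasLinearBornologyBase :=
    ⟨fun ⟨_, hn, _, h⟩ => Ballean.hasLinearBornologyBase_of_isNormal_symPower hn h,
      fun h => ⟨3, le_rfl, ⊤, h.isNormal_symPower hX (by norm_num) ⊤⟩⟩
  have h₃ : (∀ n : ℕ, 1 ≤ n → (X.power n).IsNormal) ↔ X.HasLinearBornologyBase :=
    ⟨fun h => Ballean.hasLinearBornologyBase_of_isNormal_power le_rfl (h 2 (by norm_num)),
      fun h _ hn => h.isNormal_power hX hn⟩
  have h₄ : (∃ n : ℕ, 2 ≤ n ∧ (X.power n).IsNormal) ↔ X.HasLinearBornologyBase :=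
    ⟨fun ⟨_, hn, h⟩ => Ballean.hasLinearBornologyBase_of_isNormal_power hn h,
      fun h => ⟨2, le_rfl, h.isNormal_power hX (by norm_num)⟩⟩
  -- Every condition is compared directly with the existence of a linearly ordered base.
  refine ⟨List.tfae_of_forall X.HasLinearBornologyBase _ ?_,
    fun hU => List.tfae_of_forall X.HasLinearBornologyBase _ ?_⟩
  · simp only [List.forall_mem_cons, List.not_mem_nil, false_imp_iff, implies_true, and_true]
    exact ⟨h₁, h₂, h₃, h₄⟩
  · simp only [List.forall_mem_cons, List.not_mem_nil, false_imp_iff, implies_true, and_true, true_and]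
    exact ⟨h₁, h₂, h₃, h₄,
      ⟨fun ⟨_, hn, _, h⟩ =>
          Ballean.hasLinearBornologyBase_of_isNormal_symPower_of_not_isUltranormal hU hn h,
        fun h => ⟨2, le_rfl, ⊤, h.isNormal_symPower hX (by norm_num) ⊤⟩⟩,
      ⟨fun h => Ballean.hasLinearBornologyBase_of_isNormal_symPower_of_not_isUltranormal hU le_rfl h,
        fun h => h.isNormal_symPower hX (by norm_num) ⊤⟩,
      ⟨fun h => Ballean.hasLinearBornologyBase_of_isNormal_hyperSymPower hU le_rfl h,
        fun h => h.isNormal_hyperSymPower hX (by norm_num)⟩,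
      ⟨fun ⟨_, hn, h⟩ => Ballean.hasLinearBornologyBase_of_isNormal_hyperSymPower hU hn h,
        fun h => ⟨2, le_rfl, h.isNormal_hyperSymPower hX (by norm_num)⟩⟩,
      ⟨fun h => Ballean.hasLinearBornologyBase_of_isNormal_hyperSymPower hU le_rfl (h 2 (by norm_num)),
        fun h _ hn => h.isNormal_hyperSymPower hX hn⟩,
      ⟨Ballean.hasLinearBornologyBase_of_isNormal_hyperballean hU,
        fun h => h.isNormal_hyperballean hX⟩⟩
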